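/- A Hadamard triple $(N,B,L)$ consists of an integer $N\ge 2$ and finite nonempty sets $B,L\subset\mathbb Z$ with $\#L=\#B=M\le N$ such that the matrix $H=\frac1{\sqrt M}\left[e^{-2\pi i bl/N}\right]_{b\in B,\,l\in L}$ satisfies $H^*H=I$. A Borel probability measure $\mu$ on $\mathbb R$ is called spectral if there is a countable set $\Lambda\subset\mathbb R$ such that $\{e^{2\pi i\lambda x}:\lambda\in\Lambda\}$ is an orthonormal basis of $L^2(\mu)$. For a finite nonempty set $A\subset\mathbb R$ put $\delta_A=\frac1{\#A}\sum_{a\in A}\delta_a$. Theorem. Let $\{(N_n,B_n,L_n)\}_{n\ge1}$ be a sequence of Hadamard triples with $B_n\subset\{0,1,\dots,N_n-1\}$ for all $n\ge 1$, and let $$\mu=\mu(N_n,B_n)=\delta_{\frac1{N_1}B_1}*\delta_{\frac1{N_1N_2}B_2}*\delta_{\frac1{N_1N_2N_3}B_3}*\cdots$$ be the associated Cantor–Moran measure (the weak limit of the finite convolutions). For $n\ge0$ let $\mu_{>n}=\delta_{\frac1{N_1\cdots N_{n+1}}B_{n+1}}*\delta_{\frac1{N_1\cdots N_{n+2}}B_{n+2}}*\cdots$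 be the convolution of all factors of $\mu$ except the first $n$, and let $\nu_{>n}(E)=\mu_{>n}\left((N_1\cdots N_n)^{-1}E\right)$ for Borel sets $E\subset\mathbb R$. Suppose that $\nu_{>n}$ converges weakly to $\rho=\frac12(\delta_0+\delta_1)$ as $n\to\infty$ and that $\liminf_{n\to\infty}\#B_n<\infty$. Then $\mu(N_n,B_n)$ is a spectral measure. -/

import Mathlib

open MeasureTheory ProbabilityTheory Filter Topology
open scoped ENNReal

namespace CantorMoran

noncomputable section

/-- `(N, B, L)` is a Hadamard triple: `N ≥ 2`, `B` and `L` are finite sets of integers with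
`#L = #B = M ≤ N`, and `H = M^(-1/2) [exp (-2 π i b l / N)]`, with rows indexed by `B` and columns
indexed by `L`, satisfies `H* H = I`. -/
def IsHadamardTriple (N : ℕ) (B L : Finset ℤ) : Prop :=
  2 ≤ N ∧ L.card = B.card ∧ B.card ≤ N ∧
    let H : Matrix B L ℂ := Matrix.of fun b l =>
      ((1 / Real.sqrt (B.card : ℝ) : ℝ) : ℂ) *
        Complex.exp (-(2 * Real.pi * Complex.I * (((b : ℤ) : ℂ) * ((l : ℤ) : ℂ) / (N : ℂ))))
    H.conjTranspose * H = 1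

/-- A Borel measure `μ` on `ℝ` is spectral if for some countable `Λ ⊆ ℝ` the exponentials
`x ↦ exp (2 π i l x)`, `l ∈ Λ`, form an orthonormal (Hilbert) basis of `L²(μ)`. -/
def IsSpectral (μ : Measure ℝ) : Prop :=
  ∃ Λ : Set ℝ, Λ.Countable ∧ ∃ e : HilbertBasis Λ ℂ (Lp ℂ 2 μ), ∀ l : Λ,
    (e l : ℝ → ℂ) =ᵐ[μ]
      fun x : ℝ => Complex.exp (2 * Real.pi * Complex.I * (((l : ℝ) : ℂ) * (x : ℂ)))

/-- The measure `δ_A = (1 / #A) ∑_{a ∈ A} δ_a` of a finite nonempty set `A ⊆ ℝ`. -/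
def uniformDirac (A : Finset ℝ) (hA : A.Nonempty) : ProbabilityMeasure ℝ :=
  ⟨(A.card : ℝ≥0∞)⁻¹ • ∑ a ∈ A, Measure.dirac a, ⟨by
    have h : (A.card : ℝ≥0∞) ≠ 0 := by simpa using hA.ne_empty
    simp [ENNReal.inv_mul_cancel h (ENNReal.natCast_ne_top _)]⟩⟩

/-- The measure `ρ = (1 / 2) (δ_0 + δ_1)`. -/
def rho : ProbabilityMeasure ℝ :=
  ⟨(2 : ℝ≥0∞)⁻¹ • (Measure.dirac (0 : ℝ) + Measure.dirac (1 : ℝ)), ⟨by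
    simp [ENNReal.inv_two_add_inv_two]⟩⟩

theorem measurable_tsum : Measurable fun x : ℕ → ℝ => ∑' j, x j := by
  have hset : MeasurableSet {x : ℕ → ℝ | Summable x} := by
    have : {x : ℕ → ℝ | Summable x} = {x | ∑' j, ‖x j‖ₑ ≠ ⊤} := by
      ext x
      simp only [Set.mem_ofPred_eq]
      rw [← summable_norm_iff]
      constructor
      · intro h
        simpa only [ofReal_norm] using h.tsum_ofReal_ne_top
      · intro h
        have := ENNReal.summable_toReal h
        simpa using this
    rw [this]
    have hm : Measurable fun x : ℕ → ℝ => ∑' j, ‖x j‖ₑ :=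
      Measurable.tsum fun j => (measurable_pi_apply j).enorm
    exact (hm (measurableSet_singleton ⊤)).compl
  refine measurable_of_tendsto_metrizable (f := fun n (x : ℕ → ℝ) =>
      Set.indicator {x : ℕ → ℝ | Summable x} (fun x => ∑ j ∈ Finset.range n, x j) x)
    (fun n => (Finset.measurable_sum _ fun j _ => measurable_pi_apply j).indicator hset) ?_
  rw [tendsto_pi_nhds]
  intro x
  by_cases hx : Summable x
  · simpa [Set.indicator, hx] using hx.hasSum.tendsto_sum_nat
  · simp [Set.indicator, hx, tsum_eq_zero_of_not_summable hx]

/-- The infinite convolution `m 0 ∗ m 1 ∗ m 2 ∗ ⋯`: the law of `∑ j, X j`, where the `X j` are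
independent and `X j` has law `m j`. -/
def infiniteConv (m : ℕ → ProbabilityMeasure ℝ) : ProbabilityMeasure ℝ :=
  ⟨(Measure.infinitePi fun j => (m j : Measure ℝ)).map fun x => ∑' j, x j,
    Measure.isProbabilityMeasure_map measurable_tsum.aemeasurable⟩

/-- The finite convolution `m 0 ∗ ⋯ ∗ m (n - 1)`. -/
def finiteConv (m : ℕ → ProbabilityMeasure ℝ) : ℕ → Measure ℝ
  | 0 => Measure.dirac 0
  | n + 1 => finiteConv m n ∗ (m n : Measure ℝ)

theorem finiteConv_eq_map (m : ℕ → ProbabilityMeasure ℝ) (n : ℕ) :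
    finiteConv m n = (Measure.infinitePi fun j => (m j : Measure ℝ)).map
      fun x => ∑ j ∈ Finset.range n, x j := by
  induction n with
  | zero => simp [finiteConv]
  | succ n ih =>
    have hind : iIndepFun (fun (j : ℕ) (x : ℕ → ℝ) => x j)
        (Measure.infinitePi fun j => (m j : Measure ℝ)) :=
      iIndepFun_infinitePi (P := fun j => (m j : Measure ℝ)) (X := fun _ y => y)
        (fun _ => measurable_id)
    have h := (hind.indepFun_finsetSum_of_notMem (fun j => measurable_pi_apply j)
      (Finset.notMem_range_self (n := n)))
    have e1 : (∑ j ∈ Finset.range n, fun x : ℕ → ℝ => x j) =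
        fun x => ∑ j ∈ Finset.range n, x j := by ext x; simp
    have h2 := h.map_add_eq_map_conv_map
      (by rw [e1]; exact Finset.measurable_sum _ fun j _ => measurable_pi_apply j) (measurable_pi_apply n)
    rw [e1, Measure.infinitePi_map_eval, ← ih] at h2
    rw [finiteConv, ← h2]
    congr 1
    ext x
    simp [Finset.sum_range_succ]

/-- Wherever the random series converges almost surely, `infiniteConv m` is the weak limit of the
finite convolutions. -/
theorem tendsto_finiteConv (m : ℕ → ProbabilityMeasure ℝ)
    (hm : ∀ᵐ x ∂(Measure.infinitePi fun j => (m j : Measure ℝ)), Summable x)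
    (f : BoundedContinuousFunction ℝ ℝ) :
    Tendsto (fun n => ∫ x, f x ∂(finiteConv m n)) atTop
      (𝓝 (∫ x, f x ∂(infiniteConv m : Measure ℝ))) := by
  have e : ∫ x, f x ∂(infiniteConv m : Measure ℝ) =
      ∫ x, f (∑' j, x j) ∂(Measure.infinitePi fun j => (m j : Measure ℝ)) :=
    integral_map measurable_tsum.aemeasurable f.continuous.aestronglyMeasurable
  have e' (n : ℕ) : ∫ x, f x ∂(finiteConv m n) =
      ∫ x, f (∑ j ∈ Finset.range n, x j) ∂(Measure.infinitePi fun j => (m j : Measure ℝ)) := by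
    rw [finiteConv_eq_map]
    exact integral_map (Finset.measurable_sum _ fun j _ => measurable_pi_apply j).aemeasurable
      f.continuous.aestronglyMeasurable
  rw [e]
  simp only [e']
  refine tendsto_integral_of_dominated_convergence (fun _ => ‖f‖) (fun n => ?_)
    (integrable_const _) (fun n => ae_of_all _ fun x => f.norm_coe_le_norm _) ?_
  · exact (f.continuous.measurable.comp
      (Finset.measurable_sum _ fun j _ => measurable_pi_apply j)).aestronglyMeasurable
  · filter_upwards [hm] with x hx
    exact (f.continuous.tendsto _).comp hx.hasSum.tendsto_sum_nat

/-- The measure `δ_{B_n / (N_1 ⋯ N_n)}`; the sequences are indexed from `0` here, so that `N i`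
and `B i` stand for `N_{i+1}` and `B_{i+1}`. -/
def factor (N : ℕ → ℕ) (B : ℕ → Finset ℤ) (hB : ∀ n, (B n).Nonempty) (n : ℕ) :
    ProbabilityMeasure ℝ :=
  uniformDirac ((B n).image fun b : ℤ => (b : ℝ) / ∏ i ∈ Finset.range (n + 1), (N i : ℝ))
    ((hB n).image _)

/-- The Cantor-Moran measure
`μ(N_n, B_n) = δ_{B_1 / N_1} ∗ δ_{B_2 / (N_1 N_2)} ∗ δ_{B_3 / (N_1 N_2 N_3)} ∗ ⋯`. -/
def cantorMoran (N : ℕ → ℕ) (B : ℕ → Finset ℤ) (hB : ∀ n, (B n).Nonempty) :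
    ProbabilityMeasure ℝ :=
  infiniteConv (factor N B hB)

/-- The tail `μ_{>n}` of the Cantor-Moran measure: the convolution of all factors but the
first `n`. -/
def tail (N : ℕ → ℕ) (B : ℕ → Finset ℤ) (hB : ∀ n, (B n).Nonempty) (n : ℕ) :
    ProbabilityMeasure ℝ :=
  infiniteConv fun j => factor N B hB (n + j)

/-- The measure `ν_{>n}`, `ν_{>n}(E) = μ_{>n}((N_1 ⋯ N_n)⁻¹ E)`: the image of `μ_{>n}` under
`x ↦ N_1 ⋯ N_n x`. -/
def nu (N : ℕ → ℕ) (B : ℕ → Finset ℤ) (hB : ∀ n, (B n).Nonempty) (n : ℕ) :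
    ProbabilityMeasure ℝ :=
  (tail N B hB n).map (f := fun x : ℝ => (∏ i ∈ Finset.range n, (N i : ℝ)) * x)
    (measurable_const_mul _).aemeasurable

theorem ae_summable_factor (N : ℕ → ℕ) (B : ℕ → Finset ℤ) (hB : ∀ n, (B n).Nonempty)
    (hN : ∀ n, 2 ≤ N n) (hdigits : ∀ n, ∀ b ∈ B n, 0 ≤ b ∧ b < (N n : ℤ)) (n : ℕ) :
    ∀ᵐ x ∂(Measure.infinitePi fun j => (factor N B hB (n + j) : Measure ℝ)), Summable x := by
  have hpow (k : ℕ) : (2 : ℝ) ^ k ≤ ∏ i ∈ Finset.range k, (N i : ℝ) := by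
    have h := Finset.prod_le_prod (s := Finset.range k) (f := fun _ => (2 : ℝ))
      (g := fun i => (N i : ℝ)) (fun _ _ => by norm_num) (fun i _ => by exact_mod_cast hN i)
    simpa using h
  have hfac (k : ℕ) : ∀ᵐ y ∂(factor N B hB k : Measure ℝ), ‖y‖ ≤ (1 / 2 : ℝ) ^ k := by
    have hms : MeasurableSet {y : ℝ | ‖y‖ ≤ (1 / 2 : ℝ) ^ k} :=
      measurableSet_le measurable_norm measurable_const
    rw [factor, uniformDirac, ProbabilityMeasure.coe_mk]
    refine Measure.ae_smul_measure ?_ _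
    rw [ae_iff, Measure.finsetSum_apply, Finset.sum_eq_zero]
    intro a ha
    obtain ⟨b, hb, rfl⟩ := Finset.mem_image.1 ha
    rw [← ae_iff, ae_dirac_iff hms]
    obtain ⟨h0, h1⟩ := hdigits k b hb
    have h0' : (0 : ℝ) ≤ b := by exact_mod_cast h0
    have h1' : (b : ℝ) ≤ N k := by exact_mod_cast h1.le
    have hP : (0 : ℝ) < ∏ i ∈ Finset.range k, (N i : ℝ) := lt_of_lt_of_le (by positivity) (hpow k)
    have hNk : (0 : ℝ) < N k := by exact_mod_cast (by have := hN k; omega : 0 < N k)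
    rw [Finset.prod_range_succ, Real.norm_of_nonneg (by positivity), one_div_pow,
      div_le_div_iff₀ (by positivity) (by positivity)]
    nlinarith [mul_le_mul h1' (hpow k) (by positivity) hNk.le]
  have hall : ∀ j, ∀ᵐ x ∂(Measure.infinitePi fun j => (factor N B hB (n + j) : Measure ℝ)),
      ‖x j‖ ≤ (1 / 2 : ℝ) ^ (n + j) := fun j =>
    (measurePreserving_eval_infinitePi
      (fun j => (factor N B hB (n + j) : Measure ℝ)) j).quasiMeasurePreserving.ae (hfac (n + j))
  filter_upwards [ae_all_iff.2 hall] with x hx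
  refine Summable.of_norm_bounded (g := fun j => (1 / 2 : ℝ) ^ (n + j)) ?_ hx
  simp only [pow_add]
  exact summable_geometric_two.mul_left _

/-- The Cantor-Moran measure is the weak limit of the convolutions of its first `n` factors. -/
theorem tendsto_cantorMoran (N : ℕ → ℕ) (B : ℕ → Finset ℤ) (hB : ∀ n, (B n).Nonempty)
    (hN : ∀ n, 2 ≤ N n) (hdigits : ∀ n, ∀ b ∈ B n, 0 ≤ b ∧ b < (N n : ℤ))
    (f : BoundedContinuousFunction ℝ ℝ) :
    Tendsto (fun n => ∫ x, f x ∂(finiteConv (factor N B hB) n)) atTop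
      (𝓝 (∫ x, f x ∂(cantorMoran N B hB : Measure ℝ))) :=
  tendsto_finiteConv _ (by simpa using ae_summable_factor N B hB hN hdigits 0) f

end

end CantorMoran

/-! Write `transform n` for the Fourier transform of ν_{>n}. By the Jorgensen–Pedersen criterion
(`isSpectral_of_hasSum`) it suffices to find a countable Λ with ∑_{λ ∈ Λ} |μ̂(ξ + λ)|² = 1 for every
ξ. Each finite convolution has such a spectrum, built level by level from the sets L_n. If these
spectra increase and the tail transforms at the rescaled points λ / (N_1 ⋯ N_n) stay bounded away
from zero, dominated convergence carries the identity to μ (`hasSum_norm_sq_transform`).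

The lower bound comes from moving points of a spectrum by multiples of N_1 ⋯ N_n, which changes the
rescaled point by an integer and leaves the finite transform alone. One therefore needs, for
infinitely many n, that every class x + ℤ contains a point where `transform n` is at least a fixed
ε. The limit ρ does not give this: |ρ̂(ξ)| = |cos πξ| vanishes on the whole class 1/2 + ℤ.

The remedy (`frequently_exists_le_norm_transform`) is to peel off one factor: `transform n` at ξ is
a mask at ξ / N times `transform (n + 1)` at ξ / N, where N = `N n`. Convergence to ρ forces N → ∞
(`eventually_lt_of_tendsto_nu`), while #L = #B ≤ M infinitely often. Hence x can be shifted by an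
integer so that all points (x + l) / N, l ∈ L, avoid 1/2 + ℤ (`exists_shift_away_from_half`).
Parseval over L makes the mask large at one of these points, and after an integer translation the
other factor is close to a nonzero value of |ρ̂|. -/

namespace CantorMoran

/-! ### Masks of digit sets and Parseval's identity for a Hadamard triple -/

/-- The mask `(1 / #B) ∑_{b ∈ B} exp (2 π i b ξ)` of a finite set of integers. -/
noncomputable def mask (B : Finset ℤ) (ξ : ℝ) : ℂ :=
  (B.card : ℂ)⁻¹ * ∑ b ∈ B, Complex.exp ((2 * Real.pi * b * ξ : ℝ) * Complex.I)

theorem mask_zero {B : Finset ℤ} (hB : B.Nonempty) : mask B 0 = 1 := by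
  have : (B.card : ℂ) ≠ 0 := by simpa using hB.ne_empty
  simp [mask, this]

theorem norm_mask_le_one (B : Finset ℤ) (ξ : ℝ) : ‖mask B ξ‖ ≤ 1 := by
  have h : ‖∑ b ∈ B, Complex.exp ((2 * Real.pi * b * ξ : ℝ) * Complex.I)‖ ≤ B.card := by
    refine (norm_sum_le _ _).trans (le_of_eq ?_)
    simp only [Complex.norm_exp_ofReal_mul_I]
    simp
  rw [mask, norm_mul, norm_inv, Complex.norm_natCast]
  exact inv_mul_le_one_of_le₀ h (Nat.cast_nonneg _)

theorem mask_add_intCast (B : Finset ℤ) (ξ : ℝ) (k : ℤ) : mask B (ξ + k) = mask B ξ := by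
  unfold mask
  congr 1
  refine Finset.sum_congr rfl fun b _ => Complex.exp_eq_exp_iff_exists_int.2 ⟨b * k, ?_⟩
  push_cast
  ring

theorem norm_exp_sub_exp_le (x y : ℝ) :
    ‖Complex.exp (x * Complex.I) - Complex.exp (y * Complex.I)‖ ≤ |x - y| := by
  have h : Complex.exp (x * Complex.I) - Complex.exp (y * Complex.I) =
      Complex.exp (y * Complex.I) * (Complex.exp (Complex.I * (x - y : ℝ)) - 1) := by
    rw [mul_sub, ← Complex.exp_add]
    push_cast
    ring_nf
  rw [h, norm_mul, Complex.norm_exp_ofReal_mul_I, one_mul]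
  exact Real.norm_exp_I_mul_ofReal_sub_one_le

theorem norm_mask_sub_le {B : Finset ℤ} {C : ℝ} (hC : ∀ b ∈ B, |(b : ℝ)| ≤ C) (hC0 : 0 ≤ C)
    (x y : ℝ) : ‖mask B x - mask B y‖ ≤ 2 * Real.pi * C * |x - y| := by
  have h : ‖∑ b ∈ B, (Complex.exp ((2 * Real.pi * b * x : ℝ) * Complex.I) -
      Complex.exp ((2 * Real.pi * b * y : ℝ) * Complex.I))‖ ≤
        B.card * (2 * Real.pi * C * |x - y|) := by
    rw [← nsmul_eq_mul]
    refine (norm_sum_le _ _).trans (Finset.sum_le_card_nsmul _ _ _ fun b hb => ?_)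
    refine (norm_exp_sub_exp_le _ _).trans ?_
    rw [← mul_sub, abs_mul, abs_mul, abs_of_pos Real.two_pi_pos]
    gcongr
    exact hC b hb
  rw [mask, mask, ← mul_sub, ← Finset.sum_sub_distrib, norm_mul, norm_inv, Complex.norm_natCast]
  rcases B.eq_empty_or_nonempty with rfl | hB
  · simp only [Finset.card_empty, Nat.cast_zero, inv_zero, zero_mul]
    have := Real.pi_pos
    positivity
  · rw [inv_mul_le_iff₀ (by exact_mod_cast hB.card_pos)]
    exact h

/-- Parseval's identity for the mask of a Hadamard triple. -/
theorem IsHadamardTriple.sum_norm_sq_mask {N : ℕ} {B L : Finset ℤ} (h : IsHadamardTriple N B L)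
    (hB : B.Nonempty) (ξ : ℝ) : ∑ l ∈ L, ‖mask B ((ξ + l) / N)‖ ^ 2 = 1 := by
  obtain ⟨hN, hcard, -, hH⟩ := h
  set H : Matrix B L ℂ := Matrix.of fun b l =>
      ((1 / Real.sqrt (B.card : ℝ) : ℝ) : ℂ) *
        Complex.exp (-(2 * Real.pi * Complex.I * (((b : ℤ) : ℂ) * ((l : ℤ) : ℂ) / (N : ℂ))))
    with hHdef
  replace hH : H.conjTranspose * H = 1 := hH
  have hH' : H * H.conjTranspose = 1 :=
    (Matrix.mul_eq_one_comm_of_card_eq (m := L) (n := B) (R := ℂ) (by simp [hcard])).1 hH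
  have hM : (0 : ℝ) < B.card := by exact_mod_cast hB.card_pos
  -- A unit vector whose coefficients against the columns of `H` are the mask values. `H` is square,
  -- so `H * Hᴴ = 1` and these coefficients have the same norm as `v`.
  let v : B → ℂ := fun b =>
    ((1 / Real.sqrt (B.card : ℝ) : ℝ) : ℂ) * Complex.exp ((2 * Real.pi * b * (ξ / N) : ℝ) * Complex.I)
  have hv : star v ⬝ᵥ v = 1 := by
    have (b : B) : star v b * v b = (B.card : ℂ)⁻¹ := by
      rw [Pi.star_apply, ← starRingEnd_apply, Complex.conj_mul', norm_mul,
        Complex.norm_exp_ofReal_mul_I, mul_one, Complex.norm_real, Real.norm_eq_abs, ← Complex.ofReal_pow,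
        sq_abs, div_pow, Real.sq_sqrt hM.le]
      simp
    simp only [dotProduct, this]
    simp
    exact mul_inv_cancel₀ (by exact_mod_cast hM.ne')
  have hw (l : L) : H.conjTranspose.mulVec v l = mask B ((ξ + l) / N) := by
    simp only [Matrix.mulVec, dotProduct, Matrix.conjTranspose_apply, hHdef, Matrix.of_apply, v, mask]
    rw [Finset.mul_sum, ← Finset.sum_coe_sort B]
    refine Finset.sum_congr rfl fun b _ => ?_
    rw [star_mul', ← starRingEnd_apply, ← starRingEnd_apply, Complex.conj_ofReal, ← Complex.exp_conj]
    have e : ((1 / Real.sqrt (B.card : ℝ) : ℝ) : ℂ) * ((1 / Real.sqrt (B.card : ℝ) : ℝ) : ℂ) =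
        (B.card : ℂ)⁻¹ := by
      rw [← Complex.ofReal_mul, div_mul_div_comm, Real.mul_self_sqrt hM.le]
      simp
    rw [mul_mul_mul_comm, e, ← Complex.exp_add]
    congr 2
    simp [map_ofNat (starRingEnd ℂ) 2]
    ring
  have key : star (H.conjTranspose.mulVec v) ⬝ᵥ H.conjTranspose.mulVec v = 1 := by
    rw [Matrix.star_mulVec, Matrix.conjTranspose_conjTranspose, Matrix.dotProduct_mulVec,
      Matrix.vecMul_vecMul, hH', Matrix.vecMul_one, hv]
  have : ((∑ l ∈ L, ‖mask B ((ξ + l) / N)‖ ^ 2 : ℝ) : ℂ) = 1 := by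
    rw [← key, dotProduct, ← Finset.sum_coe_sort L]
    push_cast
    refine Finset.sum_congr rfl fun l _ => ?_
    rw [Pi.star_apply, hw, ← starRingEnd_apply, Complex.conj_mul']
  exact_mod_cast this

/-! ### Fourier transforms of the finite convolutions and of the tails -/

/-- The product `N_1 ⋯ N_n`. -/
noncomputable def scale (N : ℕ → ℕ) (n : ℕ) : ℝ := ∏ i ∈ Finset.range n, (N i : ℝ)

theorem scale_succ (N : ℕ → ℕ) (n : ℕ) : scale N (n + 1) = scale N n * N n :=
  Finset.prod_range_succ _ _

theorem exists_natCast_eq_scale (N : ℕ → ℕ) (n : ℕ) : ∃ P : ℕ, (P : ℝ) = scale N n :=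
  ⟨∏ i ∈ Finset.range n, N i, by simp [scale]⟩

theorem two_pow_le_scale {N : ℕ → ℕ} (hN : ∀ n, 2 ≤ N n) (n : ℕ) : (2 : ℝ) ^ n ≤ scale N n := by
  induction n with
  | zero => simp [scale]
  | succ n ih =>
    rw [scale_succ, pow_succ]
    have : (2 : ℝ) ≤ N n := by exact_mod_cast hN n
    exact mul_le_mul ih this zero_le_two (le_trans (by positivity) ih)

theorem scale_pos {N : ℕ → ℕ} (hN : ∀ n, 2 ≤ N n) (n : ℕ) : 0 < scale N n :=
  lt_of_lt_of_le (by positivity) (two_pow_le_scale hN n)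

theorem tendsto_scale {N : ℕ → ℕ} (hN : ∀ n, 2 ≤ N n) : Tendsto (scale N) atTop atTop :=
  tendsto_atTop_mono (two_pow_le_scale hN) (tendsto_pow_atTop_atTop_of_one_lt one_lt_two)

instance (m : ℕ → ProbabilityMeasure ℝ) (n : ℕ) : IsProbabilityMeasure (finiteConv m n) := by
  rw [finiteConv_eq_map]
  exact Measure.isProbabilityMeasure_map
    (Finset.measurable_sum _ fun j _ => measurable_pi_apply j).aemeasurable

theorem charFun_finiteConv (m : ℕ → ProbabilityMeasure ℝ) (n : ℕ) (t : ℝ) :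
    charFun (finiteConv m n) t = ∏ j ∈ Finset.range n, charFun (m j : Measure ℝ) t := by
  induction n with
  | zero => simp [finiteConv, charFun_dirac]
  | succ n ih => rw [finiteConv, charFun_conv, ih, Finset.prod_range_succ]

theorem tendsto_prod_charFun (m : ℕ → ProbabilityMeasure ℝ)
    (hm : ∀ᵐ x ∂(Measure.infinitePi fun j => (m j : Measure ℝ)), Summable x) (t : ℝ) :
    Tendsto (fun n => ∏ j ∈ Finset.range n, charFun (m j : Measure ℝ) t) atTop
      (𝓝 (charFun (infiniteConv m : Measure ℝ) t)) := by
  let p (n : ℕ) : ProbabilityMeasure ℝ := ⟨finiteConv m n, inferInstance⟩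
  have h : Tendsto p atTop (𝓝 (infiniteConv m)) :=
    ProbabilityMeasure.tendsto_iff_forall_integral_tendsto.2 fun f => tendsto_finiteConv m hm f
  have h' := ProbabilityMeasure.tendsto_iff_tendsto_charFun.1 h t
  simpa only [p, ProbabilityMeasure.coe_mk, charFun_finiteConv] using h'

theorem charFun_factor {N : ℕ → ℕ} (B : ℕ → Finset ℤ) (hB : ∀ n, (B n).Nonempty)
    (hN : ∀ n, 2 ≤ N n) (k : ℕ) (ξ : ℝ) :
    charFun (factor N B hB k : Measure ℝ) (2 * Real.pi * ξ) =
      mask (B k) (ξ / scale N (k + 1)) := by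
  have hP := scale_pos hN (k + 1)
  have hinj : Function.Injective fun b : ℤ => (b : ℝ) / scale N (k + 1) := fun a b hab => by
    simpa [div_left_inj' hP.ne'] using hab
  rw [charFun_apply_real, factor, uniformDirac, ProbabilityMeasure.coe_mk, integral_smul_measure,
    integral_finsetSum_measure fun a _ => integrable_dirac (by simp)]
  simp only [integral_dirac]
  change _ • ∑ a ∈ (B k).image (fun b : ℤ => (b : ℝ) / scale N (k + 1)), _ = _
  change ((((B k).image (fun b : ℤ => (b : ℝ) / scale N (k + 1))).card : ℝ≥0∞)⁻¹).toReal • _ = _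
  rw [Finset.card_image_of_injective _ hinj, Finset.sum_image fun a _ b _ hab => hinj hab]
  rw [mask, Complex.real_smul]
  congr 1
  · simp
  · refine Finset.sum_congr rfl fun b _ => ?_
    congr 1
    push_cast
    ring

/-- The product of the masks of the levels `n, …, n + K - 1`: the Fourier transform of the
convolution of the first `K` factors of `ν_{>n}`. -/
noncomputable def partialTransform (N : ℕ → ℕ) (B : ℕ → Finset ℤ) (n K : ℕ) (ξ : ℝ) : ℂ :=
  ∏ j ∈ Finset.range K, mask (B (n + j)) (scale N n * ξ / scale N (n + j + 1))

/-- The Fourier transform of `ν_{>n}`. -/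
noncomputable def transform (N : ℕ → ℕ) (B : ℕ → Finset ℤ) (hB : ∀ n, (B n).Nonempty) (n : ℕ)
    (ξ : ℝ) : ℂ :=
  charFun (nu N B hB n : Measure ℝ) (2 * Real.pi * ξ)

section

variable {N : ℕ → ℕ} {B : ℕ → Finset ℤ}

theorem partialTransform_succ (n K : ℕ) (ξ : ℝ) : partialTransform N B n (K + 1) ξ =
    partialTransform N B n K ξ * mask (B (n + K)) (scale N n * ξ / scale N (n + K + 1)) :=
  Finset.prod_range_succ _ _

theorem partialTransform_succ' (hN : ∀ n, 2 ≤ N n) (n K : ℕ) (ξ : ℝ) :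
    partialTransform N B n (K + 1) ξ =
      mask (B n) (ξ / N n) * partialTransform N B (n + 1) K (ξ / N n) := by
  have h0 := (scale_pos hN n).ne'
  have h1 : (N n : ℝ) ≠ 0 := by have := hN n; positivity
  rw [partialTransform, Finset.prod_range_succ', mul_comm]
  congr 1
  · rw [add_zero, scale_succ, mul_div_mul_left _ _ h0]
  · refine Finset.prod_congr rfl fun j _ => ?_
    rw [show n + (j + 1) = n + 1 + j by ring, scale_succ N n]
    congr 2
    field_simp

theorem norm_partialTransform_le_one (n K : ℕ) (ξ : ℝ) : ‖partialTransform N B n K ξ‖ ≤ 1 := by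
  rw [partialTransform, norm_prod]
  exact Finset.prod_le_one (fun _ _ => norm_nonneg _) fun _ _ => norm_mask_le_one _ _

theorem partialTransform_zero_right (hB : ∀ n, (B n).Nonempty) (n K : ℕ) :
    partialTransform N B n K 0 = 1 :=
  Finset.prod_eq_one fun j _ => by rw [mul_zero, zero_div, mask_zero (hB _)]

/-- Every denominator in the first `n` masks divides `scale N n`, so each mask argument moves by an
integer. This is the freedom used to relocate points of a spectrum. -/
theorem partialTransform_add_scale_mul (hN : ∀ n, 2 ≤ N n) (n : ℕ) (ξ : ℝ) (k : ℤ) :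
    partialTransform N B 0 n (ξ + scale N n * k) = partialTransform N B 0 n ξ := by
  induction n generalizing k with
  | zero => simp [partialTransform]
  | succ n ih =>
    have hs : scale N 0 = 1 := by simp [scale]
    rw [partialTransform_succ, partialTransform_succ, zero_add, hs, one_mul, one_mul, add_div,
      mul_div_cancel_left₀ _ (scale_pos hN _).ne', mask_add_intCast]
    have := ih (N n * k)
    push_cast at this
    rw [scale_succ, mul_assoc, this]

/-- The constant does not depend on `n` or `K`. The first mask contributes 2π because its digits are
at most `N n`; the remaining product is evaluated at arguments divided by `N n ≥ 2`, so the
inductive 4π becomes at most 2π. -/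
theorem norm_partialTransform_sub_le (hN : ∀ n, 2 ≤ N n)
    (hdigits : ∀ n, ∀ b ∈ B n, 0 ≤ b ∧ b < (N n : ℤ)) (n K : ℕ) (x y : ℝ) :
    ‖partialTransform N B n K x - partialTransform N B n K y‖ ≤ 4 * Real.pi * |x - y| := by
  induction K generalizing n x y with
  | zero =>
    have := Real.pi_pos
    simp only [partialTransform, Finset.range_zero, Finset.prod_empty, sub_self, norm_zero]
    positivity
  | succ K ih =>
    have hn : (2 : ℝ) ≤ N n := by exact_mod_cast hN n
    have hn0 : (0 : ℝ) < N n := by linarith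
    have hm : ‖mask (B n) (x / N n) - mask (B n) (y / N n)‖ ≤ 2 * Real.pi * |x - y| := by
      refine (norm_mask_sub_le (C := N n) (fun b hb => ?_) hn0.le _ _).trans (le_of_eq ?_)
      · obtain ⟨h0, h1⟩ := hdigits n b hb
        rw [abs_of_nonneg (by exact_mod_cast h0)]
        exact_mod_cast h1.le
      · rw [← sub_div, abs_div, abs_of_pos hn0]
        field_simp
    have hp : ‖partialTransform N B (n + 1) K (x / N n) - partialTransform N B (n + 1) K (y / N n)‖
        ≤ 2 * Real.pi * |x - y| := by
      refine (ih (n + 1) _ _).trans ?_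
      rw [← sub_div, abs_div, abs_of_pos hn0, mul_div_assoc', div_le_iff₀ hn0]
      have := mul_nonneg Real.pi_pos.le (abs_nonneg (x - y))
      nlinarith
    rw [partialTransform_succ' hN, partialTransform_succ' hN]
    generalize mask (B n) (x / N n) = a at *
    generalize hb : mask (B n) (y / N n) = b at *
    generalize hu : partialTransform N B (n + 1) K (x / N n) = u at *
    generalize partialTransform N B (n + 1) K (y / N n) = v at *
    have h1 : ‖b‖ ≤ 1 := hb ▸ norm_mask_le_one _ _
    have h2 : ‖u‖ ≤ 1 := hu ▸ norm_partialTransform_le_one _ _ _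
    calc ‖a * u - b * v‖ = ‖(a - b) * u + b * (u - v)‖ := by ring_nf
      _ ≤ ‖a - b‖ * ‖u‖ + ‖b‖ * ‖u - v‖ := (norm_add_le _ _).trans (by rw [norm_mul, norm_mul])
      _ ≤ ‖a - b‖ * 1 + 1 * ‖u - v‖ := by gcongr
      _ ≤ 4 * Real.pi * |x - y| := by linarith

variable (hB : ∀ n, (B n).Nonempty)

theorem transform_zero_left (ξ : ℝ) : transform N B hB 0 ξ =
    charFun (cantorMoran N B hB : Measure ℝ) (2 * Real.pi * ξ) := by
  rw [transform, nu, ProbabilityMeasure.toMeasure_map, charFun_map_mul, tail, cantorMoran]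
  simp

theorem tendsto_partialTransform (hN : ∀ n, 2 ≤ N n)
    (hdigits : ∀ n, ∀ b ∈ B n, 0 ≤ b ∧ b < (N n : ℤ)) (n : ℕ) (ξ : ℝ) :
    Tendsto (fun K => partialTransform N B n K ξ) atTop (𝓝 (transform N B hB n ξ)) := by
  have h := tendsto_prod_charFun (fun j => factor N B hB (n + j))
    (ae_summable_factor N B hB hN hdigits n) (2 * Real.pi * (scale N n * ξ))
  simp only [charFun_factor B hB hN] at h
  rw [transform, nu, ProbabilityMeasure.toMeasure_map, charFun_map_mul, tail]
  rw [show (∏ i ∈ Finset.range n, (N i : ℝ)) * (2 * Real.pi * ξ) =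
    2 * Real.pi * (scale N n * ξ) by rw [scale]; ring]
  exact h

theorem transform_zero (n : ℕ) : transform N B hB n 0 = 1 := by
  simp [transform]

theorem norm_transform_sub_le (hN : ∀ n, 2 ≤ N n)
    (hdigits : ∀ n, ∀ b ∈ B n, 0 ≤ b ∧ b < (N n : ℤ)) (n : ℕ) (x y : ℝ) :
    ‖transform N B hB n x - transform N B hB n y‖ ≤ 4 * Real.pi * |x - y| :=
  le_of_tendsto ((tendsto_partialTransform hB hN hdigits n x).sub
    (tendsto_partialTransform hB hN hdigits n y)).norm
    (Eventually.of_forall fun K => norm_partialTransform_sub_le hN hdigits n K x y)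

theorem transform_eq_mask_mul (hN : ∀ n, 2 ≤ N n)
    (hdigits : ∀ n, ∀ b ∈ B n, 0 ≤ b ∧ b < (N n : ℤ)) (n : ℕ) (ξ : ℝ) :
    transform N B hB n ξ = mask (B n) (ξ / N n) * transform N B hB (n + 1) (ξ / N n) := by
  refine tendsto_nhds_unique ((tendsto_partialTransform hB hN hdigits n ξ).comp
    (tendsto_add_atTop_nat 1)) ?_
  simp only [Function.comp_def, partialTransform_succ' hN]
  exact (tendsto_partialTransform hB hN hdigits (n + 1) _).const_mul _

theorem transform_zero_eq_partialTransform_mul (hN : ∀ n, 2 ≤ N n)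
    (hdigits : ∀ n, ∀ b ∈ B n, 0 ≤ b ∧ b < (N n : ℤ)) (n : ℕ) (ξ : ℝ) :
    transform N B hB 0 ξ =
      partialTransform N B 0 n ξ * transform N B hB n (ξ / scale N n) := by
  induction n with
  | zero => simp [partialTransform, scale]
  | succ n ih =>
    have hs : scale N 0 = 1 := by simp [scale]
    rw [ih, partialTransform_succ, transform_eq_mask_mul hB hN hdigits n, zero_add, hs, one_mul,
      div_div, ← scale_succ, mul_assoc]

end

/-! ### Lower bounds for the tail transforms from convergence to ρ -/

theorem norm_charFun_rho (ξ : ℝ) :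
    ‖charFun (rho : Measure ℝ) (2 * Real.pi * ξ)‖ = |Real.cos (Real.pi * ξ)| := by
  have h : charFun (rho : Measure ℝ) (2 * Real.pi * ξ) =
      Complex.exp ((Real.pi * ξ : ℝ) * Complex.I) * (Real.cos (Real.pi * ξ) : ℝ) := by
    rw [charFun_apply_real, rho, ProbabilityMeasure.coe_mk, integral_smul_measure,
      integral_add_measure (integrable_dirac (by simp)) (integrable_dirac (by simp)),
      integral_dirac, integral_dirac, Complex.ofReal_cos, Complex.cos, Complex.real_smul,
      mul_div_assoc']
    have h1 : Complex.exp ((2 * Real.pi * ξ : ℝ) * (1 : ℝ) * Complex.I) =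
        Complex.exp ((Real.pi * ξ : ℝ) * Complex.I) * Complex.exp ((Real.pi * ξ : ℝ) * Complex.I) := by
      rw [← Complex.exp_add]
      push_cast
      ring_nf
    have h2 : Complex.exp ((Real.pi * ξ : ℝ) * Complex.I) *
        Complex.exp (-(Real.pi * ξ : ℝ) * Complex.I) = 1 := by
      rw [← Complex.exp_add, neg_mul, add_neg_cancel, Complex.exp_zero]
    rw [h1, mul_add (Complex.exp _), h2]
    simp only [ENNReal.toReal_inv, ENNReal.toReal_ofNat, Complex.ofReal_zero, mul_zero, zero_mul,
      Complex.exp_zero]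
    push_cast
    ring
  rw [h, norm_mul, Complex.norm_exp_ofReal_mul_I, one_mul, Complex.norm_real, Real.norm_eq_abs]

/-- Among the translates of `L / N` by multiples of `1 / N`, one stays away from `1 / 2 + ℤ`,
provided that `L` is small compared with `N`. -/
theorem exists_shift_away_from_half {L : Finset ℤ} {M N : ℕ} (hL : L.card ≤ M)
    (hN : 4 * (M + 1) ≤ N) (x : ℝ) :
    ∃ c : ℤ, ∀ l ∈ L, ∃ j : ℤ, |(x + c + l) / N - j| ≤ 1 / 2 - 1 / (8 * (M + 1)) := by
  by_contra! hcon
  set η : ℝ := 1 / (8 * (M + 1)) with hη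
  set q : ℕ := N / (M + 1) with hq
  have hq1 : q * (M + 1) ≤ N := Nat.div_mul_le_self _ _
  have hq2 : N < (q + 1) * (M + 1) := by
    rw [hq, mul_comm]
    exact Nat.lt_mul_div_succ _ (Nat.succ_pos _)
  have hq4 : 4 ≤ q := (Nat.le_div_iff_mul_le (Nat.succ_pos _)).2 hN
  -- Test the `M + 1` shifts `i * q`, `i ≤ M`. If each one fails, each has an offending element of
  -- `L`; as `L` has at most `M` elements, two shifts share one.
  choose f hfL hf using fun i : ℕ => hcon (i * q : ℕ)
  have main (i i' : ℕ) (hi : i < i') (hi' : i' < M + 1) : f i ≠ f i' := by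
    intro hff
    have h1 := hf i
    have h2 := hf i'
    rw [← hff] at h2
    have hN0 : (0 : ℝ) < N := by exact_mod_cast (by omega : 0 < N)
    have hq1' : (q : ℝ) * (M + 1) ≤ N := by exact_mod_cast hq1
    have hq2' : (N : ℝ) < (q + 1) * (M + 1) := by exact_mod_cast hq2
    have hq4' : (4 : ℝ) ≤ q := by exact_mod_cast hq4
    obtain ⟨e, rfl⟩ : ∃ e, i' = i + e := ⟨i' - i, by omega⟩
    have he1 : (1 : ℝ) ≤ e := by exact_mod_cast (by omega : 1 ≤ e)
    have heM : (e : ℝ) ≤ M := by exact_mod_cast (by omega : e ≤ M)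
    have hM0 : (0 : ℝ) < M + 1 := by positivity
    set t : ℝ := (x + ((i * q : ℕ) : ℤ) + f i) / N with ht
    set d : ℝ := e * q / N with hd
    have ht2 : (x + (((i + e) * q : ℕ) : ℤ) + f i) / N = t + d := by
      rw [ht, hd, ← add_div]
      push_cast
      ring
    rw [ht2] at h2
    have hd1 : 2 * η < d := by
      rw [hη, hd, mul_one_div, div_lt_div_iff₀ (by positivity) hN0]
      nlinarith [mul_le_mul_of_nonneg_right he1 (by positivity : 0 ≤ (q : ℝ) * (M + 1))]
    have hd2 : d < 1 - 2 * η := by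
      have h3 : d ≤ M / (M + 1) := by
        rw [hd, div_le_div_iff₀ hN0 hM0]
        nlinarith [mul_le_mul_of_nonneg_right heM (by positivity : 0 ≤ (q : ℝ) * (M + 1))]
      have h4 : (M : ℝ) / (M + 1) = 1 - 8 * η := by rw [hη]; field_simp; ring
      have : 0 < η := by positivity
      linarith
    -- The fractional parts of `t` and `t + d` both lie within `η` of 1/2, so `d` is within 2η of an
    -- integer, contrary to 2η < d < 1 - 2η.
    have a1 := h1 ⌊t⌋
    have a2 := h1 (⌊t⌋ + 1)
    have b1 := h2 ⌊t + d⌋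
    have b2 := h2 (⌊t + d⌋ + 1)
    push_cast at a2 b2
    have := Int.floor_le t
    have := Int.lt_floor_add_one t
    have := Int.floor_le (t + d)
    have := Int.lt_floor_add_one (t + d)
    rw [abs_of_nonneg (by linarith)] at a1 b1
    rw [abs_of_neg (by linarith)] at a2 b2
    rcases le_or_gt ⌊t + d⌋ ⌊t⌋ with h | h
    · have : (⌊t + d⌋ : ℝ) ≤ ⌊t⌋ := by exact_mod_cast h
      linarith
    · have : (⌊t⌋ : ℝ) + 1 ≤ ⌊t + d⌋ := by exact_mod_cast h
      linarith
  obtain ⟨i, hi, i', hi', hne, hff⟩ := Finset.exists_ne_map_eq_of_card_lt_of_maps_to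
    (s := Finset.range (M + 1)) (t := L) (f := f) (by simpa using Nat.lt_succ_of_le hL)
    (fun i _ => hfL i)
  rw [Finset.mem_range] at hi hi'
  rcases lt_or_gt_of_ne hne with h | h
  · exact main i i' h hi' hff
  · exact main i' i h hi hff.symm

section

variable {N : ℕ → ℕ} {B : ℕ → Finset ℤ} {hB : ∀ n, (B n).Nonempty}

theorem tendsto_norm_transform (hnu : Tendsto (fun n => nu N B hB n) atTop (𝓝 rho)) (ξ : ℝ) :
    Tendsto (fun n => ‖transform N B hB n ξ‖) atTop (𝓝 |Real.cos (Real.pi * ξ)|) := by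
  rw [← norm_charFun_rho]
  exact (ProbabilityMeasure.tendsto_iff_tendsto_charFun.1 hnu _).norm

/-- Since masks are bounded by 1, |`transform n` at 1| ≤ |`transform (n + 1)` at 1 / `N n`|. The
left side tends to |cos π| = 1; if `N n` took a value k ≥ 2 infinitely often, the right side would
tend to cos(π / k) < 1 along those n. -/
theorem eventually_lt_of_tendsto_nu (hN : ∀ n, 2 ≤ N n)
    (hdigits : ∀ n, ∀ b ∈ B n, 0 ≤ b ∧ b < (N n : ℤ))
    (hnu : Tendsto (fun n => nu N B hB n) atTop (𝓝 rho)) (K : ℕ) : ∀ᶠ n in atTop, K < N n := by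
  have h (k : ℕ) (hk : 2 ≤ k) :
      ∀ᶠ n in atTop, ‖transform N B hB (n + 1) (1 / k)‖ < ‖transform N B hB n 1‖ := by
    refine Tendsto.eventually_lt
      ((tendsto_norm_transform hnu (1 / k)).comp (tendsto_add_atTop_nat 1))
      (tendsto_norm_transform hnu 1) ?_
    have hk' : (2 : ℝ) ≤ k := by exact_mod_cast hk
    have h0 : 0 < Real.pi * (1 / k) := by have := Real.pi_pos; positivity
    have h1 : Real.pi * (1 / k) ≤ Real.pi / 2 := by
      rw [mul_one_div]
      exact div_le_div_of_nonneg_left Real.pi_pos.le two_pos hk'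
    have h2 : Real.cos (Real.pi * (1 / k)) < 1 := by
      refine lt_of_lt_of_eq ?_ Real.cos_zero
      exact Real.cos_lt_cos_of_nonneg_of_le_pi_div_two le_rfl h1 h0
    rw [abs_of_nonneg (Real.cos_nonneg_of_neg_pi_div_two_le_of_le (by linarith) h1)]
    simpa using h2
  have h' : ∀ᶠ n in atTop, ∀ k ∈ Finset.Icc 2 K,
      ‖transform N B hB (n + 1) (1 / k)‖ < ‖transform N B hB n 1‖ :=
    (eventually_all_finset _).2 fun k hk => h k (Finset.mem_Icc.1 hk).1
  filter_upwards [h'] with n hn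
  by_contra! hle
  have := hn (N n) (Finset.mem_Icc.2 ⟨hN n, hle⟩)
  rw [transform_eq_mask_mul hB hN hdigits n, norm_mul] at this
  have := mul_le_of_le_one_left (norm_nonneg (transform N B hB (n + 1) (1 / N n)))
    (norm_mask_le_one (B n) (1 / N n))
  linarith

/-- The limit |cos πt| has a positive minimum on the interval. Pointwise convergence at a finite net
suffices, because the transforms share a Lipschitz constant. -/
theorem eventually_le_norm_transform (hN : ∀ n, 2 ≤ N n)
    (hdigits : ∀ n, ∀ b ∈ B n, 0 ≤ b ∧ b < (N n : ℤ))
    (hnu : Tendsto (fun n => nu N B hB n) atTop (𝓝 rho)) {η : ℝ} (hη : 0 < η) (hη' : η < 1 / 2) :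
    ∃ c > 0, ∀ᶠ n in atTop, ∀ t : ℝ, |t| ≤ 1 / 2 - η → c ≤ ‖transform N B hB n t‖ := by
  have hpi := Real.pi_pos
  set s := Real.cos (Real.pi * (1 / 2 - η)) with hs
  have hs0 : 0 < s :=
    Real.cos_pos_of_mem_Ioo ⟨by nlinarith, by nlinarith⟩
  have hcos (t : ℝ) (ht : |t| ≤ 1 / 2 - η) : s ≤ |Real.cos (Real.pi * t)| := by
    refine le_trans ?_ (le_abs_self _)
    rw [← Real.cos_abs (Real.pi * t), abs_mul, abs_of_pos hpi]
    exact Real.cos_le_cos_of_nonneg_of_le_pi (by positivity) (by nlinarith) (by gcongr)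
  -- Chosen so that the Lipschitz error 4πδ is s / 4, which leaves 3s / 4 - s / 4 = s / 2.
  set δ : ℝ := s / (16 * Real.pi) with hδ
  have hδ0 : 0 < δ := by positivity
  obtain ⟨T, hT, hcov⟩ := (isCompact_Icc (a := -(1 / 2 - η)) (b := 1 / 2 - η)).elim_nhds_subcover
    (fun t => Metric.ball t δ) fun t _ => Metric.ball_mem_nhds t hδ0
  refine ⟨s / 2, by positivity, ?_⟩
  have hev : ∀ᶠ n in atTop, ∀ t ∈ T, 3 * s / 4 < ‖transform N B hB n t‖ :=
    (eventually_all_finset _).2 fun t ht => (tendsto_norm_transform hnu t).eventually_const_lt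
      (lt_of_lt_of_le (by linarith) (hcos t (abs_le.2 (hT t ht))))
  filter_upwards [hev] with n hn t ht
  obtain ⟨t', ht', htt'⟩ := Set.mem_iUnion₂.1 (hcov (abs_le.1 ht))
  have h1 := hn t' ht'
  have h2 := norm_transform_sub_le hB hN hdigits n t' t
  have h3 : 4 * Real.pi * |t' - t| ≤ s / 4 := by
    rw [Metric.mem_ball, dist_comm, Real.dist_eq] at htt'
    calc 4 * Real.pi * |t' - t| ≤ 4 * Real.pi * δ := by gcongr
      _ = s / 4 := by rw [hδ]; field_simp; norm_num
  have h4 := norm_sub_norm_le (transform N B hB n t') (transform N B hB n t)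
  linarith

/-- Along infinitely many levels, every class modulo `1` contains a point at which the Fourier
transform of `ν_{>n}` is bounded away from zero. -/
theorem frequently_exists_le_norm_transform {L : ℕ → Finset ℤ}
    (hH : ∀ n, IsHadamardTriple (N n) (B n) (L n))
    (hdigits : ∀ n, ∀ b ∈ B n, 0 ≤ b ∧ b < (N n : ℤ))
    (hnu : Tendsto (fun n => nu N B hB n) atTop (𝓝 rho))
    (hliminf : liminf (fun n => ((B n).card : ℕ∞)) atTop < ⊤) :
    ∃ ε > 0, ∃ᶠ n in atTop, ∀ x : ℝ, ∃ k : ℤ, ε ≤ ‖transform N B hB n (x + k)‖ := by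
  have hN (n : ℕ) : 2 ≤ N n := (hH n).1
  obtain ⟨M, hM⟩ := ENat.ne_top_iff_exists.1 hliminf.ne
  have hfreq : ∃ᶠ n in atTop, (B n).card ≤ M := by
    have : liminf (fun n => ((B n).card : ℕ∞)) atTop < (M + 1 : ℕ) := by
      rw [← hM]
      exact_mod_cast Nat.lt_succ_self M
    refine (frequently_lt_of_liminf_lt (by isBoundedDefault) this).mono fun n hn => ?_
    exact Nat.lt_succ_iff.1 (by exact_mod_cast hn)
  have hM0 : (0 : ℝ) < M + 1 := by positivity
  obtain ⟨c, hc, hev⟩ := eventually_le_norm_transform (η := 1 / (8 * (M + 1))) hN hdigits hnu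
    (by positivity) (by
      rw [div_lt_div_iff₀ (by positivity) two_pos]
      have : (0 : ℝ) ≤ M := by positivity
      linarith)
  refine ⟨(1 / (M + 1)) * c, by positivity, ?_⟩
  refine ((hfreq.and_eventually (eventually_lt_of_tendsto_nu hN hdigits hnu
    (4 * (M + 1)))).and_eventually ((tendsto_add_atTop_nat 1).eventually hev)).mono fun n hn x => ?_
  obtain ⟨⟨hcard, hNn⟩, hc'⟩ := hn
  have hLcard : (L n).card ≤ M := (hH n).2.1.trans_le hcard
  obtain ⟨a, ha⟩ := exists_shift_away_from_half hLcard hNn.le x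
  -- At most `M` squares add up to 1, so they cannot all be below 1 / (M + 1).
  obtain ⟨l, hl, hml⟩ : ∃ l ∈ L n, 1 / (M + 1 : ℝ) ≤ ‖mask (B n) ((x + a + l) / N n)‖ ^ 2 := by
    by_contra! hlt
    have h1 := (hH n).sum_norm_sq_mask (hB n) (x + a)
    have h2 := Finset.sum_le_card_nsmul (L n) _ _ fun l hl => (hlt l hl).le
    rw [h1, nsmul_eq_mul, mul_one_div, le_div_iff₀ hM0, one_mul] at h2
    have : ((L n).card : ℝ) ≤ M := by exact_mod_cast hLcard
    linarith
  obtain ⟨j, hj⟩ := ha l hl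
  have hN0 : (N n : ℝ) ≠ 0 := by have := hN n; positivity
  -- After division by `N n`, the term `N n * j` is an integer translation: it preserves the mask
  -- and brings the argument of `transform (n + 1)` into the interval where `hc'` applies.
  refine ⟨a + l - N n * j, ?_⟩
  have e : (x + ((a + l - N n * j : ℤ) : ℝ)) / N n = (x + a + l) / N n - j := by
    push_cast
    field_simp
    ring
  rw [transform_eq_mask_mul hB hN hdigits, e, norm_mul]
  have h1 := hc' _ hj
  have e2 : mask (B n) ((x + a + l) / N n - j) = mask (B n) ((x + a + l) / N n) := by
    have := mask_add_intCast (B n) ((x + a + l) / N n) (-j)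
    rwa [Int.cast_neg, ← sub_eq_add_neg] at this
  rw [e2]
  have h2 : 1 / (M + 1 : ℝ) ≤ ‖mask (B n) ((x + a + l) / N n)‖ :=
    hml.trans (pow_le_of_le_one (norm_nonneg _) (norm_mask_le_one _ _) two_ne_zero)
  gcongr

end

/-! ### Spectra of the finite convolutions and passage to the limit -/

/-- `Λ` is a spectrum of the convolution of the first `n` factors of the Cantor-Moran measure, in
terms of its Fourier transform. -/
def IsPartialSpectrum (N : ℕ → ℕ) (B : ℕ → Finset ℤ) (n : ℕ) (Λ : Finset ℤ) : Prop :=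
  ∀ ξ : ℝ, ∑ l ∈ Λ, ‖partialTransform N B 0 n (ξ + l)‖ ^ 2 = 1

section

variable {N : ℕ → ℕ} {B : ℕ → Finset ℤ}

/-- Injectivity of `g` on `s` is automatic: if two indices had the same image, then at ξ = -g i two
terms would equal 1 and the sum would exceed 1. -/
theorem isPartialSpectrum_image {ι : Type*} (hB : ∀ n, (B n).Nonempty) {n : ℕ} {s : Finset ι}
    {g : ι → ℤ} (h : ∀ ξ : ℝ, ∑ i ∈ s, ‖partialTransform N B 0 n (ξ + g i)‖ ^ 2 = 1) :
    IsPartialSpectrum N B n (s.image g) := by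
  have hinj : Set.InjOn g s := by
    intro i hi j hj hij
    by_contra hne
    have h1 := Finset.add_le_sum (f := fun i' => ‖partialTransform N B 0 n (-(g i : ℝ) + g i')‖ ^ 2)
      (fun _ _ => by positivity) hi hj hne
    rw [h, ← hij, neg_add_cancel, partialTransform_zero_right hB] at h1
    norm_num at h1
  intro ξ
  rw [Finset.sum_image hinj]
  exact h ξ

theorem isPartialSpectrum_zero : IsPartialSpectrum N B 0 {0} := fun ξ => by
  simp [partialTransform]

variable {L : ℕ → Finset ℤ}

/-- The new spectrum is Λ + N_1 ⋯ N_n (L - l₀). The old transform ignores the added multiples, and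
summing the new mask over `L` gives 1. Subtracting l₀ ∈ L keeps the old points. -/
theorem IsPartialSpectrum.exists_succ (hB : ∀ n, (B n).Nonempty)
    (hH : ∀ n, IsHadamardTriple (N n) (B n) (L n)) {n : ℕ} {Λ : Finset ℤ}
    (h : IsPartialSpectrum N B n Λ) : ∃ Λ', Λ ⊆ Λ' ∧ IsPartialSpectrum N B (n + 1) Λ' := by
  have hN (n : ℕ) : 2 ≤ N n := (hH n).1
  obtain ⟨P, hP⟩ := exists_natCast_eq_scale N n
  have hP0 := (scale_pos hN n).ne'
  have hN0 : (N n : ℝ) ≠ 0 := by have := hN n; positivity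
  obtain ⟨l₀, hl₀⟩ : (L n).Nonempty := by
    rw [← Finset.card_pos, (hH n).2.1]
    exact (hB n).card_pos
  refine ⟨(Λ ×ˢ L n).image fun p => p.1 + P * (p.2 - l₀), fun l hl => ?_,
    isPartialSpectrum_image hB fun ξ => ?_⟩
  · exact Finset.mem_image.2 ⟨(l, l₀), Finset.mk_mem_product hl hl₀, by simp⟩
  · rw [Finset.sum_product, ← h ξ]
    refine Finset.sum_congr rfl fun l _ => ?_
    rw [← mul_one (‖_‖ ^ 2), ← (hH n).sum_norm_sq_mask (hB n) ((ξ + l) / scale N n - l₀),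
      Finset.mul_sum]
    refine Finset.sum_congr rfl fun a _ => ?_
    have e : ξ + ((l + P * (a - l₀) : ℤ) : ℝ) = (ξ + l) + scale N n * ((a - l₀ : ℤ) : ℝ) := by
      push_cast
      rw [hP]
      ring
    have hs : scale N 0 = 1 := by simp [scale]
    rw [e, partialTransform_succ, partialTransform_add_scale_mul hN, norm_mul, mul_pow, zero_add, hs,
      one_mul, scale_succ]
    congr 4
    push_cast
    field_simp
    ring

theorem IsPartialSpectrum.exists_of_le (hB : ∀ n, (B n).Nonempty)
    (hH : ∀ n, IsHadamardTriple (N n) (B n) (L n)) {n n' : ℕ} (hn : n ≤ n') {Λ : Finset ℤ}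
    (h : IsPartialSpectrum N B n Λ) : ∃ Λ', Λ ⊆ Λ' ∧ IsPartialSpectrum N B n' Λ' := by
  induction n', hn using Nat.le_induction with
  | base => exact ⟨Λ, subset_rfl, h⟩
  | succ m _ ih =>
    obtain ⟨Λ₁, h₁, hs₁⟩ := ih
    obtain ⟨Λ₂, h₂, hs₂⟩ := hs₁.exists_succ hB hH
    exact ⟨Λ₂, h₁.trans h₂, hs₂⟩

variable {hB : ∀ n, (B n).Nonempty}

/-- Go to a level so far out that the old points, rescaled, are near 0, where the tail transform is
near 1; these points stay fixed. Each new point is moved by a multiple of the scale to a place where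
the tail transform is at least `ε`. -/
theorem IsPartialSpectrum.exists_le_norm_transform
    (hH : ∀ n, IsHadamardTriple (N n) (B n) (L n))
    (hdigits : ∀ n, ∀ b ∈ B n, 0 ≤ b ∧ b < (N n : ℤ)) {ε : ℝ}
    (hε : ∃ᶠ n in atTop, ∀ x : ℝ, ∃ k : ℤ, ε ≤ ‖transform N B hB n (x + k)‖) {n : ℕ}
    {Λ : Finset ℤ} (h : IsPartialSpectrum N B n Λ) :
    ∃ n' Λ', n < n' ∧ Λ ⊆ Λ' ∧ IsPartialSpectrum N B n' Λ' ∧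
      ∀ l ∈ Λ', min ε (1 / 2) ≤ ‖transform N B hB n' (l / scale N n')‖ := by
  have hN (n : ℕ) : 2 ≤ N n := (hH n).1
  have hev : ∀ᶠ m in atTop, ∀ l ∈ Λ, 4 * Real.pi * |(l : ℝ) / scale N m - 0| < 1 / 2 := by
    refine (eventually_all_finset _).2 fun l _ => ?_
    have h0 : Tendsto (fun m => 4 * Real.pi * |(l : ℝ) / scale N m - 0|) atTop
        (𝓝 (4 * Real.pi * |(0 : ℝ) - 0|)) :=
      (((tendsto_const_nhds.div_atTop (tendsto_scale hN)).sub_const 0).abs).const_mul _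
    exact h0.eventually_lt_const (by norm_num)
  obtain ⟨n', ⟨hk, hsmall⟩, hlt⟩ := ((hε.and_eventually hev).and_eventually
    (eventually_gt_atTop n)).exists
  obtain ⟨Λ₁, hsub, h₁⟩ := h.exists_of_le hB hH hlt.le
  choose k hk using hk
  obtain ⟨P, hP⟩ := exists_natCast_eq_scale N n'
  have hP0 := (scale_pos hN n').ne'
  let κ (l : ℤ) : ℤ := if l ∈ Λ then 0 else k (l / scale N n')
  refine ⟨n', Λ₁.image fun l => l + P * κ l, hlt, fun l hl => ?_,
    isPartialSpectrum_image hB fun ξ => ?_, ?_⟩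
  · exact Finset.mem_image.2 ⟨l, hsub hl, by simp [κ, hl]⟩
  · rw [← h₁ ξ]
    refine Finset.sum_congr rfl fun l _ => ?_
    rw [← partialTransform_add_scale_mul hN n' (ξ + l) (κ l), ← hP]
    push_cast
    rw [add_assoc]
  · intro l' hl'
    obtain ⟨l, hl, rfl⟩ := Finset.mem_image.1 hl'
    have e : ((l + P * κ l : ℤ) : ℝ) / scale N n' = l / scale N n' + κ l := by
      push_cast
      rw [hP]
      field_simp
    rw [e]
    by_cases hlΛ : l ∈ Λ
    · refine (min_le_right _ _).trans ?_
      simp only [κ, if_pos hlΛ, Int.cast_zero, add_zero]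
      have h1 := hsmall l hlΛ
      have h2 := norm_transform_sub_le hB hN hdigits n' (l / scale N n') 0
      have h3 := norm_sub_norm_le (transform N B hB n' 0) (transform N B hB n' (l / scale N n'))
      rw [norm_sub_rev] at h3
      rw [transform_zero] at h2 h3
      rw [norm_one] at h3
      linarith
    · refine (min_le_left _ _).trans ?_
      simp only [κ, if_neg hlΛ]
      exact hk _

/-- An increasing sequence of spectra of finite convolutions on which the Fourier transforms of the
tails are bounded away from zero. -/
theorem exists_monotone_isPartialSpectrum
    (hH : ∀ n, IsHadamardTriple (N n) (B n) (L n))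
    (hdigits : ∀ n, ∀ b ∈ B n, 0 ≤ b ∧ b < (N n : ℤ)) {ε : ℝ}
    (hε : ∃ᶠ n in atTop, ∀ x : ℝ, ∃ k : ℤ, ε ≤ ‖transform N B hB n (x + k)‖) :
    ∃ (n : ℕ → ℕ) (Λ : ℕ → Finset ℤ), StrictMono n ∧ Monotone Λ ∧
      (∀ k, IsPartialSpectrum N B (n k) (Λ k)) ∧
      ∀ k, ∀ l ∈ Λ k, min ε (1 / 2) ≤ ‖transform N B hB (n k) (l / scale N (n k))‖ := by
  have step (p : {p : ℕ × Finset ℤ // IsPartialSpectrum N B p.1 p.2}) :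
      ∃ q : {p : ℕ × Finset ℤ // IsPartialSpectrum N B p.1 p.2}, p.1.1 < q.1.1 ∧ p.1.2 ⊆ q.1.2 ∧
        ∀ l ∈ q.1.2, min ε (1 / 2) ≤ ‖transform N B hB q.1.1 (l / scale N q.1.1)‖ := by
    obtain ⟨n', Λ', h1, h2, h3, h4⟩ := p.2.exists_le_norm_transform hH hdigits hε
    exact ⟨⟨(n', Λ'), h3⟩, h1, h2, h4⟩
  choose next hlt hsub hle using step
  let s (k : ℕ) := next^[k] (⟨(0, {0}), isPartialSpectrum_zero⟩)
  have hs (k : ℕ) : s (k + 1) = next (s k) := Function.iterate_succ_apply' _ _ _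
  -- The sequence starts at `s 1`: the seed `s 0` is not an output of `next`, so no lower bound is
  -- known for it.
  refine ⟨fun k => (s (k + 1)).1.1, fun k => (s (k + 1)).1.2, strictMono_nat_of_lt_succ fun k => ?_,
    monotone_nat_of_le_succ fun k => ?_, fun k => (s (k + 1)).2, fun k => ?_⟩
  · rw [hs (k + 1)]
    exact hlt _
  · rw [hs (k + 1)]
    exact hsub _
  · beta_reduce
    rw [hs k]
    exact hle _

/-- Parseval's identity for the Cantor-Moran measure and the union of an increasing sequence of
spectra of finite convolutions. -/
theorem hasSum_norm_sq_transform (hN : ∀ n, 2 ≤ N n)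
    (hdigits : ∀ n, ∀ b ∈ B n, 0 ≤ b ∧ b < (N n : ℤ)) {n : ℕ → ℕ} {Λ : ℕ → Finset ℤ}
    (hn : StrictMono n) (hΛ : Monotone Λ) (hspec : ∀ k, IsPartialSpectrum N B (n k) (Λ k)) {ε : ℝ}
    (hε : 0 < ε) (hle : ∀ k, ∀ l ∈ Λ k, ε ≤ ‖transform N B hB (n k) (l / scale N (n k))‖) (ξ : ℝ) :
    HasSum (fun l : ⋃ k, (Λ k : Set ℤ) => ‖transform N B hB 0 (ξ + (l : ℤ))‖ ^ 2) 1 := by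
  set S : Set ℤ := ⋃ k, (Λ k : Set ℤ) with hS
  set a : ℤ → ℝ := S.indicator fun l => ‖transform N B hB 0 (ξ + l)‖ ^ 2 with ha
  set f : ℕ → ℤ → ℝ := fun k => (Λ k : Set ℤ).indicator
    fun l => ‖partialTransform N B 0 (n k) (ξ + l)‖ ^ 2 with hf
  have hsum (k : ℕ) : HasSum (f k) 1 := by
    rw [← hspec k ξ]
    rw [show ∑ l ∈ Λ k, ‖partialTransform N B 0 (n k) (ξ + l)‖ ^ 2 = ∑ l ∈ Λ k, f k l from
      Finset.sum_congr rfl fun l hl => by simp [hf, hl]]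
    exact hasSum_sum_of_ne_finset_zero fun l hl => by simp [hf, hl]
  have hf0 (k : ℕ) (l : ℤ) : 0 ≤ f k l := Set.indicator_nonneg (fun _ _ => by positivity) _
  have ha0 (l : ℤ) : 0 ≤ a l := Set.indicator_nonneg (fun _ _ => by positivity) _
  have hlim (l : ℤ) : Tendsto (fun k => f k l) atTop (𝓝 (a l)) := by
    by_cases hl : l ∈ S
    · obtain ⟨k₀, hk₀⟩ := Set.mem_iUnion.1 hl
      have h1 : Tendsto (fun k => ‖partialTransform N B 0 (n k) (ξ + l)‖ ^ 2) atTop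
          (𝓝 (‖transform N B hB 0 (ξ + l)‖ ^ 2)) :=
        (((tendsto_partialTransform hB hN hdigits 0 (ξ + l)).comp hn.tendsto_atTop).norm).pow 2
      rw [ha, Set.indicator_of_mem hl]
      refine h1.congr' ?_
      filter_upwards [eventually_ge_atTop k₀] with k hk
      exact (Set.indicator_of_mem (Finset.mem_coe.2 (hΛ hk hk₀))
        fun l : ℤ => ‖partialTransform N B 0 (n k) (ξ + l)‖ ^ 2).symm
    · have h2 (k : ℕ) : f k l = 0 :=
        Set.indicator_of_notMem (fun h => hl (Set.mem_iUnion.2 ⟨k, h⟩)) _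
      simp only [h2, ha, Set.indicator_of_notMem hl]
      exact tendsto_const_nhds
  -- Fatou's argument: each finite sum of `a` is a limit of finite sums of `f k`, which are at most
  -- 1.
  have hsumm : Summable a := summable_of_sum_le ha0 fun u =>
    le_of_tendsto (tendsto_finsetSum u fun l _ => hlim l)
      (Eventually.of_forall fun k => sum_le_hasSum u (fun l _ => hf0 k l) (hsum k))
  -- The full transform is the partial one times the tail. For large k the shift by ξ / `scale N (n
  -- k)` costs the tail less than ε / 2, so it is still at least ε / 2 on `Λ k`.
  have hbound : ∀ᶠ k in atTop, ∀ l, ‖f k l‖ ≤ (2 / ε) ^ 2 * a l := by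
    have hsc : ∀ᶠ k in atTop, 4 * Real.pi * |ξ / scale N (n k)| < ε / 2 := by
      have h0 : Tendsto (fun k => 4 * Real.pi * |ξ / scale N (n k)|) atTop
          (𝓝 (4 * Real.pi * |(0 : ℝ)|)) :=
        ((tendsto_const_nhds.div_atTop
          ((tendsto_scale hN).comp hn.tendsto_atTop)).abs).const_mul _
      exact h0.eventually_lt_const (by simpa using half_pos hε)
    filter_upwards [hsc] with k hk l
    rw [Real.norm_of_nonneg (hf0 k l)]
    by_cases hl : l ∈ Λ k
    · have hlS : l ∈ S := Set.mem_iUnion.2 ⟨k, hl⟩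
      rw [hf, ha]
      simp only [Set.indicator_of_mem hlS, Set.indicator_of_mem (Finset.mem_coe.2 hl)]
      rw [← mul_pow, transform_zero_eq_partialTransform_mul hB hN hdigits (n k), norm_mul]
      have h1 := hle k l hl
      have h2 := norm_transform_sub_le hB hN hdigits (n k) ((ξ + l) / scale N (n k))
        (l / scale N (n k))
      have h3 := norm_sub_norm_le (transform N B hB (n k) (l / scale N (n k)))
        (transform N B hB (n k) ((ξ + l) / scale N (n k)))
      rw [norm_sub_rev] at h3
      rw [← sub_div, add_sub_cancel_right] at h2
      have h4 : ε / 2 ≤ ‖transform N B hB (n k) ((ξ + l) / scale N (n k))‖ := by linarith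
      refine pow_le_pow_left₀ (norm_nonneg _) ?_ 2
      rw [div_mul_eq_mul_div, le_div_iff₀ hε]
      nlinarith [norm_nonneg (partialTransform N B 0 (n k) (ξ + l))]
    · have : f k l = 0 := Set.indicator_of_notMem (fun h => hl (Finset.mem_coe.1 h)) _
      rw [this]
      exact mul_nonneg (by positivity) (ha0 l)
  have htend := tendsto_tsum_of_dominated_convergence (hsumm.mul_left ((2 / ε) ^ 2)) hlim hbound
  simp only [fun k => (hsum k).tsum_eq] at htend
  have h1 : ∑' l, a l = 1 := (tendsto_nhds_unique htend tendsto_const_nhds)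
  have h2 : HasSum a 1 := h1 ▸ hsumm.hasSum
  exact hasSum_subtype_iff_indicator.2 h2

end

/-! ### Totality of the exponentials and the Jorgensen–Pedersen criterion -/

/-- The finite measures g⁺μ and g⁻μ have the same characteristic function, hence coincide, so g⁺ =
g⁻ almost everywhere. -/
theorem ae_eq_zero_of_integral_exp_mul_ofReal_eq_zero {μ : Measure ℝ} [IsFiniteMeasure μ]
    {g : ℝ → ℝ} (hg : Integrable g μ)
    (h : ∀ t : ℝ, ∫ x, Complex.exp (t * x * Complex.I) * (g x : ℂ) ∂μ = 0) : g =ᵐ[μ] 0 := by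
  have hm : AEMeasurable (fun x => ENNReal.ofReal (g x)) μ := hg.1.aemeasurable.ennreal_ofReal
  have hm' : AEMeasurable (fun x => ENNReal.ofReal (-g x)) μ :=
    hg.neg.1.aemeasurable.ennreal_ofReal
  have : IsFiniteMeasure (μ.withDensity fun x => ENNReal.ofReal (g x)) :=
    isFiniteMeasure_withDensity_ofReal hg.2
  have : IsFiniteMeasure (μ.withDensity fun x => ENNReal.ofReal (-g x)) :=
    isFiniteMeasure_withDensity_ofReal hg.neg.2
  have hexp (t : ℝ) : Continuous fun x : ℝ => Complex.exp (t * x * Complex.I) := by fun_prop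
  have hint {u : ℝ → ℝ} (hu : Integrable u μ) (t : ℝ) :
      Integrable (fun x => (ENNReal.ofReal (u x)).toReal • Complex.exp (t * x * Complex.I)) μ := by
    refine hu.norm.mono' (hu.1.aemeasurable.ennreal_ofReal.ennreal_toReal.aestronglyMeasurable.smul
      (hexp t).aestronglyMeasurable) (ae_of_all _ fun x => ?_)
    rw [norm_smul, ← Complex.ofReal_mul, Complex.norm_exp_ofReal_mul_I, mul_one,
      ENNReal.toReal_ofReal', Real.norm_eq_abs, Real.norm_eq_abs, abs_of_nonneg (le_max_right _ _)]
    exact max_le (le_abs_self _) (abs_nonneg _)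
  have heq : μ.withDensity (fun x => ENNReal.ofReal (g x)) =
      μ.withDensity fun x => ENNReal.ofReal (-g x) := by
    refine Measure.ext_of_charFun (funext fun t => sub_eq_zero.1 ?_)
    rw [charFun_apply_real, charFun_apply_real,
      integral_withDensity_eq_integral_toReal_smul₀ hm (by simp),
      integral_withDensity_eq_integral_toReal_smul₀ hm' (by simp),
      ← integral_sub (hint hg t) (by simpa using hint hg.neg t), ← h t]
    refine integral_congr_ae (ae_of_all _ fun x => ?_)
    beta_reduce
    rw [← sub_smul, ENNReal.toReal_ofReal', ENNReal.toReal_ofReal', Complex.real_smul, mul_comm]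
    congr 2
    rcases le_total 0 (g x) with h0 | h0
    · rw [max_eq_left h0, max_eq_right (by linarith), sub_zero]
    · rw [max_eq_right h0, max_eq_left (by linarith)]
      ring
  have hne : ∫⁻ x, ENNReal.ofReal (g x) ∂μ ≠ ⊤ := by
    rw [← setLIntegral_univ, ← withDensity_apply _ MeasurableSet.univ]
    exact measure_ne_top _ _
  filter_upwards [(withDensity_eq_iff hm hm' hne).1 heq] with x hx
  have h1 := congrArg ENNReal.toReal hx
  rw [ENNReal.toReal_ofReal', ENNReal.toReal_ofReal'] at h1
  rcases le_total 0 (g x) with h0 | h0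
  · rwa [max_eq_left h0, max_eq_right (by linarith)] at h1
  · rw [max_eq_right h0, max_eq_left (by linarith)] at h1
    simpa using h1.symm

/-- The exponentials are total in the integrable functions of a finite measure on `ℝ`. -/
theorem ae_eq_zero_of_integral_exp_mul_eq_zero {μ : Measure ℝ} [IsFiniteMeasure μ]
    {f : ℝ → ℂ} (hf : Integrable f μ)
    (h : ∀ t : ℝ, ∫ x, Complex.exp (t * x * Complex.I) * f x ∂μ = 0) : f =ᵐ[μ] 0 := by
  have hexp (t : ℝ) : Continuous fun x : ℝ => Complex.exp (t * x * Complex.I) := by fun_prop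
  have hint {u : ℝ → ℂ} (hu : Integrable u μ) (t : ℝ) :
      Integrable (fun x : ℝ => Complex.exp (t * x * Complex.I) * u x) μ := by
    refine hu.norm.mono' ((hexp t).aestronglyMeasurable.mul hu.1) (ae_of_all _ fun x => ?_)
    rw [norm_mul, ← Complex.ofReal_mul, Complex.norm_exp_ofReal_mul_I, one_mul]
  have hfc : Integrable (fun x => (starRingEnd ℂ) (f x)) μ :=
    (Complex.conjLIE.integrable_comp_iff (φ := f)).2 hf
  have h' (t : ℝ) : ∫ x, Complex.exp (t * x * Complex.I) * (starRingEnd ℂ) (f x) ∂μ = 0 := by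
    have := congrArg (starRingEnd ℂ) (h (-t))
    rw [← integral_conj, map_zero] at this
    rw [← this]
    refine integral_congr_ae (ae_of_all _ fun x => ?_)
    simp [← Complex.exp_conj]
  have hre : (fun x => (f x).re) =ᵐ[μ] 0 :=
    ae_eq_zero_of_integral_exp_mul_ofReal_eq_zero hf.re fun t => by
      have e (x : ℝ) : Complex.exp (t * x * Complex.I) * ((f x).re : ℂ) = (2 : ℂ)⁻¹ *
          (Complex.exp (t * x * Complex.I) * f x +
            Complex.exp (t * x * Complex.I) * (starRingEnd ℂ) (f x)) := by
        rw [← mul_add, Complex.add_conj]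
        push_cast
        ring
      simp only [e]
      rw [integral_const_mul, integral_add (hint hf t) (hint hfc t), h, h', add_zero, mul_zero]
  have him : (fun x => (f x).im) =ᵐ[μ] 0 :=
    ae_eq_zero_of_integral_exp_mul_ofReal_eq_zero hf.im fun t => by
      have e (x : ℝ) : Complex.exp (t * x * Complex.I) * ((f x).im : ℂ) = (2 * Complex.I)⁻¹ *
          (Complex.exp (t * x * Complex.I) * f x -
            Complex.exp (t * x * Complex.I) * (starRingEnd ℂ) (f x)) := by
        rw [← mul_sub, Complex.sub_conj]
        push_cast
        field_simp
      simp only [e]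
      rw [integral_const_mul, integral_sub (hint hf t) (hint hfc t), h, h', sub_zero, mul_zero]
  filter_upwards [hre, him] with x h1 h2
  exact Complex.ext h1 h2

theorem memLp_exp (μ : Measure ℝ) [IsFiniteMeasure μ] (l : ℝ) : MemLp
    (fun x : ℝ => Complex.exp (2 * Real.pi * Complex.I * ((l : ℂ) * (x : ℂ)))) 2 μ := by
  refine MemLp.of_bound (C := 1) (by fun_prop) (ae_of_all _ fun x => le_of_eq ?_)
  rw [← Complex.norm_exp_ofReal_mul_I (2 * Real.pi * l * x)]
  congr 2
  push_cast
  ring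

/-- The exponential `x ↦ exp (2 π i l x)` as an element of `L²(μ)`. -/
noncomputable def expLp (μ : Measure ℝ) [IsFiniteMeasure μ] (l : ℝ) : Lp ℂ 2 μ :=
  (memLp_exp μ l).toLp

theorem inner_expLp (μ : Measure ℝ) [IsFiniteMeasure μ] (a : ℝ) (f : Lp ℂ 2 μ) :
    inner ℂ (expLp μ a) f =
      ∫ x, Complex.exp ((-(2 * Real.pi * a) : ℝ) * x * Complex.I) * f x ∂μ := by
  rw [L2.inner_def]
  refine integral_congr_ae ?_
  filter_upwards [(memLp_exp μ a).coeFn_toLp] with x hx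
  rw [expLp, hx, RCLike.inner_apply, mul_comm, ← Complex.exp_conj]
  congr 2
  simp [map_ofNat (starRingEnd ℂ) 2]
  ring

theorem inner_expLp_expLp (μ : Measure ℝ) [IsFiniteMeasure μ] (a b : ℝ) :
    inner ℂ (expLp μ a) (expLp μ b) = charFun μ (2 * Real.pi * (-a + b)) := by
  rw [inner_expLp, charFun_apply_real]
  refine integral_congr_ae ?_
  filter_upwards [(memLp_exp μ b).coeFn_toLp] with x hx
  rw [expLp, hx, ← Complex.exp_add]
  congr 1
  push_cast
  ring

/-- Equality in Bessel's inequality puts `e` in the closed span of `v`. Concretely, subtracting a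
finite projection of `e` does not change its inner product with `f`, and the remainder tends to 0 in
norm. -/
theorem inner_eq_zero_of_hasSum_norm_inner_sq {E ι : Type*} [NormedAddCommGroup E]
    [InnerProductSpace ℂ E] {v : ι → E} (hv : Orthonormal ℂ v) {e f : E}
    (he : HasSum (fun i => ‖inner ℂ (v i) e‖ ^ 2) (‖e‖ ^ 2)) (hf : ∀ i, inner ℂ (v i) f = 0) :
    inner ℂ e f = 0 := by
  have hle (s : Finset ι) : ‖inner ℂ e f‖ ^ 2 ≤
      (‖e‖ ^ 2 - ∑ i ∈ s, ‖inner ℂ (v i) e‖ ^ 2) * ‖f‖ ^ 2 := by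
    set w : E := ∑ i ∈ s, inner ℂ (v i) e • v i with hw
    have h1 : inner ℂ (e - w) f = inner ℂ e f := by
      rw [inner_sub_left, hw, sum_inner]
      simp [inner_smul_left, hf]
    have h2 : inner ℂ w e = ((∑ i ∈ s, ‖inner ℂ (v i) e‖ ^ 2 : ℝ) : ℂ) := by
      rw [hw, sum_inner]
      push_cast
      exact Finset.sum_congr rfl fun i _ => by rw [inner_smul_left, Complex.conj_mul']
    have h3 : inner ℂ w w = ((∑ i ∈ s, ‖inner ℂ (v i) e‖ ^ 2 : ℝ) : ℂ) := by
      rw [hw, hv.inner_sum]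
      push_cast
      exact Finset.sum_congr rfl fun i _ => Complex.conj_mul' _
    have h4 : ‖e - w‖ ^ 2 = ‖e‖ ^ 2 - ∑ i ∈ s, ‖inner ℂ (v i) e‖ ^ 2 := by
      have h5 : ‖w‖ ^ 2 = ∑ i ∈ s, ‖inner ℂ (v i) e‖ ^ 2 := by
        rw [← inner_self_eq_norm_sq (𝕜 := ℂ), h3]
        exact Complex.ofReal_re _
      have h6 := norm_sub_sq (𝕜 := ℂ) e w
      rw [inner_re_symm, h2, h5] at h6
      have : RCLike.re ((∑ i ∈ s, ‖inner ℂ (v i) e‖ ^ 2 : ℝ) : ℂ) =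
        ∑ i ∈ s, ‖inner ℂ (v i) e‖ ^ 2 := Complex.ofReal_re _
      rw [this] at h6
      linarith
    rw [← h1, ← h4, ← mul_pow]
    gcongr
    exact norm_inner_le_norm _ _
  have hlim : Tendsto (fun s : Finset ι =>
      (‖e‖ ^ 2 - ∑ i ∈ s, ‖inner ℂ (v i) e‖ ^ 2) * ‖f‖ ^ 2) atTop
      (𝓝 ((‖e‖ ^ 2 - ‖e‖ ^ 2) * ‖f‖ ^ 2)) := (he.const_sub _).mul_const _
  have h0 := ge_of_tendsto hlim (Eventually.of_forall hle)
  rw [sub_self, zero_mul] at h0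
  exact norm_eq_zero.1 (pow_eq_zero_iff two_ne_zero |>.1 (le_antisymm h0 (by positivity)))

/-- The Jorgensen-Pedersen criterion: a probability measure on `ℝ` is spectral as soon as the squared
moduli of the translates of its Fourier transform by a countable set sum up to `1`. -/
theorem isSpectral_of_hasSum {μ : Measure ℝ} [IsProbabilityMeasure μ] {S : Set ℝ}
    (hS : S.Countable)
    (h : ∀ ξ : ℝ, HasSum (fun l : S => ‖charFun μ (2 * Real.pi * (ξ + l))‖ ^ 2) 1) :
    IsSpectral μ := by
  have hnorm (x : ℝ) : ‖expLp μ x‖ = 1 := by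
    have h1 : inner ℂ (expLp μ x) (expLp μ x) = 1 := by
      rw [inner_expLp_expLp]
      simp
    have h2 := inner_self_eq_norm_sq (𝕜 := ℂ) (expLp μ x)
    rw [h1, RCLike.one_re] at h2
    exact (pow_eq_one_iff_of_nonneg (norm_nonneg _) two_ne_zero).1 h2.symm
  have hsum (x : ℝ) : HasSum (fun l : S => ‖inner ℂ (expLp μ (l : ℝ)) (expLp μ x)‖ ^ 2) 1 := by
    have h1 (l : S) : ‖inner ℂ (expLp μ (l : ℝ)) (expLp μ x)‖ =
        ‖charFun μ (2 * Real.pi * (-x + l))‖ := by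
      rw [norm_inner_symm, inner_expLp_expLp]
    simpa only [h1] using h (-x)
  have horth : Orthonormal ℂ fun l : S => expLp μ (l : ℝ) := by
    refine ⟨fun l => hnorm l, fun a b hab => ?_⟩
    -- At x = b the term of index `b` is already 1, the whole sum, so the term of index `a` must
    -- vanish.
    have h1 := sum_le_hasSum {a, b} (fun _ _ => by positivity) (hsum (b : ℝ))
    rw [Finset.sum_pair hab, inner_self_eq_norm_sq_to_K, hnorm] at h1
    have h2 : ‖inner ℂ (expLp μ (a : ℝ)) (expLp μ (b : ℝ))‖ ^ 2 ≤ 0 := by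
      simpa using h1
    exact norm_eq_zero.1 (pow_eq_zero_iff two_ne_zero |>.1 (le_antisymm h2 (by positivity)))
  have hbot : (Submodule.span ℂ (Set.range fun l : S => expLp μ (l : ℝ)))ᗮ = ⊥ := by
    rw [Submodule.eq_bot_iff]
    intro f hf
    have hperp (l : S) : inner ℂ (expLp μ (l : ℝ)) f = 0 :=
      Submodule.mem_orthogonal _ _ |>.1 hf _ (Submodule.subset_span ⟨l, rfl⟩)
    -- The hypothesis at -x is Parseval's equality for the exponential of frequency `x`, so `f` is
    -- orthogonal to every exponential and not only to those from `S`.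
    have hall (x : ℝ) : inner ℂ (expLp μ x) f = 0 :=
      inner_eq_zero_of_hasSum_norm_inner_sq horth (by simpa [hnorm] using hsum x) hperp
    have hint : Integrable (f : ℝ → ℂ) μ := (Lp.memLp f).integrable one_le_two
    refine (Lp.eq_zero_iff_ae_eq_zero).2 (ae_eq_zero_of_integral_exp_mul_eq_zero hint fun t => ?_)
    have h1 := hall (-t / (2 * Real.pi))
    rw [inner_expLp] at h1
    have h2 : -(2 * Real.pi * (-t / (2 * Real.pi))) = t := by
      have := Real.pi_pos
      field_simp
    rwa [h2] at h1
  refine ⟨S, hS, HilbertBasis.mkOfOrthogonalEqBot horth hbot, fun l => ?_⟩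
  rw [HilbertBasis.coe_mkOfOrthogonalEqBot]
  exact (memLp_exp μ l).coeFn_toLp

end CantorMoran

theorem theorem1p4 (N : ℕ → ℕ) (B L : ℕ → Finset ℤ)
    (hB : ∀ n, (B n).Nonempty)
    (hH : ∀ n, CantorMoran.IsHadamardTriple (N n) (B n) (L n))
    (hdigits : ∀ n, ∀ b ∈ B n, 0 ≤ b ∧ b < (N n : ℤ))
    (hnu : Tendsto (fun n => CantorMoran.nu N B hB n) atTop (𝓝 CantorMoran.rho))
    (hliminf : liminf (fun n => ((B n).card : ℕ∞)) atTop < ⊤) :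
    CantorMoran.IsSpectral (CantorMoran.cantorMoran N B hB : Measure ℝ) := by
  have hN (n : ℕ) : 2 ≤ N n := (hH n).1
  obtain ⟨ε, hε, hfreq⟩ :=
    CantorMoran.frequently_exists_le_norm_transform hH hdigits hnu hliminf
  obtain ⟨n, Λ, hn, hΛ, hspec, hle⟩ :=
    CantorMoran.exists_monotone_isPartialSpectrum hH hdigits hfreq
  refine CantorMoran.isSpectral_of_hasSum (S := (fun l : ℤ => (l : ℝ)) '' ⋃ k, (Λ k : Set ℤ))
    ((Set.to_countable _).image _) fun ξ => ?_
  rw [← (Equiv.Set.image (fun l : ℤ => (l : ℝ)) (⋃ k, (Λ k : Set ℤ))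
    Int.cast_injective).hasSum_iff]
  have h := CantorMoran.hasSum_norm_sq_transform hN hdigits hn hΛ hspec
    (lt_min hε one_half_pos) hle ξ
  simp only [CantorMoran.transform_zero_left] at h
  exact h
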